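/- Let $K\subset\mathbb R^2$ be a strictly convex planar body (a compact convex set with non-empty interior whose boundary contains no segment) with differentiable boundary (through every boundary point of $K$ there passes exactly one support line), and let $\alpha\in(0,\pi)$ be a fixed angle. Put $u(t)=(\cos t,\sin t)$, $u'(t)=(-\sin t,\cos t)$, and let $p(t)=\max_{x\in K}\langle u(t),x\rangle$ be the support function of $K$. Let $$\gamma(t)=p(t)u(t)+p'(t)u'(t)$$ be the point at which the support line $\ell(t)$ of $K$ with outward normal $u(t)$ touches $K$, and let $$\gamma_\alpha(t)=p(t)u(t)+\Bigl[p(t)\cot\alpha+\frac{1}{\sin\alpha}\,p(t+\pi-\alpha)\Bigr]u'(t)$$ be the parametrization of the $\alpha$-isoptic curve of $K$, i.e. the intersection point of $\ell(t)$ and $\ell(t+\pi-\alpha)$. Define $$c(t)=|\gamma_\alpha(t)-\gamma_\alpha(t+\pi-\alpha)|,\qquad q(t)=|\gamma(t)-\gamma(t+\pi-\alpha)|.$$ Suppose that there are positive numbers $c_0$ and $q_0$ such that $c(t)=c_0$ and $q(t)=q_0$ for every $t\in[0,2\pi]$. Then $K$ is a disc. -/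

import Mathlib

namespace PlanarIsoptic

noncomputable section

/-- The Euclidean plane. -/
abbrev Plane : Type := EuclideanSpace ℝ (Fin 2)

/-- The unit vector `u(t) = (cos t, sin t)`. -/
def u (t : ℝ) : Plane := !₂[Real.cos t, Real.sin t]

/-- Its derivative `u'(t) = (-sin t, cos t)`. -/
def u' (t : ℝ) : Plane := !₂[-Real.sin t, Real.cos t]

/-- The support function `p(t) = max_{x ∈ K} ⟨u(t), x⟩`
(the supremum is a maximum when `K` is compact and non-empty). -/
def supportFn (K : Set Plane) (t : ℝ) : ℝ :=
  sSup ((fun x : Plane => inner ℝ (u t) x) '' K)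

/-- The support line `ℓ(t)` of `K` with outward normal vector `u(t)`. -/
def supportLine (K : Set Plane) (t : ℝ) : Set Plane :=
  {x | inner ℝ (u t) x = supportFn K t}

/-- A planar convex body has differentiable boundary: through every boundary point
there passes exactly one support line (the tangent line at that point). -/
def HasDifferentiableBoundary (K : Set Plane) : Prop :=
  ∀ x ∈ frontier K, ∃! L : Set Plane, (∃ t : ℝ, L = supportLine K t) ∧ x ∈ L

/-- The contact point of `ℓ(t)` with `K`: `γ(t) = p(t) u(t) + p'(t) u'(t)`.
The support function of a strictly convex body is differentiable. -/
def contactPt (K : Set Plane) (t : ℝ) : Plane :=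
  supportFn K t • u t + deriv (supportFn K) t • u' t

/-- The parametrized `α`-isoptic curve
`γ_α(t) = p(t) u(t) + [p(t) cot α + p(t + π - α) / sin α] u'(t)`,
the common point of the support lines `ℓ(t)` and `ℓ(t + π - α)`. -/
def isopticPt (K : Set Plane) (α t : ℝ) : Plane :=
  supportFn K t • u t +
    (supportFn K t * Real.cot α + (1 / Real.sin α) * supportFn K (t + Real.pi - α)) • u' t

/-- `c(t) = |γ_α(t) - γ_α(t + π - α)|`, the length of the chord of the isoptic curve
lying on the support line `ℓ(t + π - α)`. -/
def isopticChord (K : Set Plane) (α t : ℝ) : ℝ :=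
  dist (isopticPt K α t) (isopticPt K α (t + Real.pi - α))

/-- `q(t) = |γ(t) - γ(t + π - α)|`, the length of the chord of `K` joining the contact points
of the two support lines through `γ_α(t)`. -/
def contactChord (K : Set Plane) (α t : ℝ) : ℝ :=
  dist (contactPt K t) (contactPt K (t + Real.pi - α))

/-- A (closed, non-degenerate) disc. -/
def IsDisc (K : Set Plane) : Prop :=
  ∃ (z : Plane) (r : ℝ), 0 < r ∧ K = Metric.closedBall z r

end

end PlanarIsoptic

/-!
Write `b = π - α`, let `p` be the support function of `K`, and say that a function `f` satisfies the
*rotation recurrence* when `f (t + 2 b) = 2 cos b f (t + b) - f t`.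

The chord of the isoptic lying on `ℓ(t + b)` has signed length
`(p (t + 2 b) - 2 cos b p (t + b) + p t) / sin b`. By hypothesis its absolute value is the constant
`c₀ > 0`, so by continuity it is itself constant, and `f = p - r` satisfies the rotation recurrence
for a suitable constant `r ≠ 0` (`exists_const_rotationRecurrence`).

Put `h t = (f (t + b) - cos b f t) / sin b` and `a = f' - h`; then `a` satisfies the rotation
recurrence too. The squared length of the contact chord is
`2 r² (1 - cos b) + (a₁² + a₀² - 2 cos b a₀ a₁) + 2 r sin b (a₁ - a₀)` with `a₀ = a t` and
`a₁ = a (t + b)` (`contactChord_sq`). The quadratic form in brackets is invariant under the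
recurrence, so constancy of the chord makes `a (t + b) - a t` invariant under `t ↦ t + b`. Together
with the recurrence this gives `(1 - cos b) a = 0`, hence `a = 0`. Therefore `f' = h`, and the
recurrence yields `h' = -f`, so `f` is a combination of `cos` and `sin`
(`eq_cos_sin_of_deriv_eq`). Thus `p` is the support function of a disc, and a convex body is
determined by its support function (`eq_closedBall_of_supportFn_eq`).

The contact chord involves `p'`, so one also needs that the support function of a strictly convex
body is differentiable (`differentiable_supportFn`): its support points are unique, hence depend
continuously on the direction, and the envelope argument applies.
-/

namespace PlanarIsoptic

open Real Filter Topology Asymptotics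

/-! ### The rotating frame -/

lemma inner_plane (x y : Plane) : inner ℝ x y = x 0 * y 0 + x 1 * y 1 := by
  simp [PiLp.inner_apply, Fin.sum_univ_two, mul_comm]

lemma inner_u (t : ℝ) (x : Plane) : inner ℝ (u t) x = cos t * x 0 + sin t * x 1 := by
  simp [inner_plane, u]

lemma norm_u (t : ℝ) : ‖u t‖ = 1 := by
  simp [EuclideanSpace.norm_eq, Fin.sum_univ_two, u]

lemma norm_u' (t : ℝ) : ‖u' t‖ = 1 := by
  simp [EuclideanSpace.norm_eq, Fin.sum_univ_two, u']

lemma hasDerivAt_u (t : ℝ) : HasDerivAt u (u' t) t := by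
  rw [← hasDerivWithinAt_univ, hasDerivWithinAt_iff_hasFDerivWithinAt, hasFDerivWithinAt_euclidean]
  intro i
  rw [hasFDerivWithinAt_univ, hasFDerivAt_iff_hasDerivAt]
  fin_cases i
  · simpa [u, u'] using hasDerivAt_cos t
  · simpa [u, u'] using hasDerivAt_sin t

lemma exists_eq_norm_smul_u (x : Plane) : ∃ t : ℝ, x = ‖x‖ • u t := by
  have hn : ‖x‖ = ‖(⟨x 0, x 1⟩ : ℂ)‖ := by
    rw [Complex.norm_def, Complex.normSq_mk, EuclideanSpace.norm_eq, Fin.sum_univ_two]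
    simp [sq]
  refine ⟨Complex.arg ⟨x 0, x 1⟩, ?_⟩
  ext i
  fin_cases i
  · simp [u, hn, Complex.norm_mul_cos_arg]
  · simp [u, hn, Complex.norm_mul_sin_arg]

/-! ### The support function -/

section Support

variable {K : Set Plane}

lemma inner_le_supportFn (hK : IsCompact K) (t : ℝ) {x : Plane} (hx : x ∈ K) :
    inner ℝ (u t) x ≤ supportFn K t :=
  le_csSup (hK.image (by fun_prop)).bddAbove ⟨x, hx, rfl⟩

lemma exists_inner_eq_supportFn (hK : IsCompact K) (hne : K.Nonempty) (t : ℝ) :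
    ∃ x ∈ K, inner ℝ (u t) x = supportFn K t :=
  (hK.image (by fun_prop)).sSup_mem (hne.image _)

lemma supportFn_add_two_pi (K : Set Plane) (t : ℝ) :
    supportFn K (t + 2 * π) = supportFn K t := by
  simp [supportFn, u]

/-- A support line meets a strictly convex body in a single point: otherwise the midpoint of two
common points would be interior to the body and could be moved outwards. -/
lemma eq_of_inner_eq_supportFn (hK : IsCompact K) (hs : StrictConvex ℝ K) {t : ℝ} {x y : Plane}
    (hx : x ∈ K) (hy : y ∈ K) (hxt : inner ℝ (u t) x = supportFn K t)
    (hyt : inner ℝ (u t) y = supportFn K t) : x = y := by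
  by_contra hne
  have hm := hs hx hy hne (by norm_num : (0 : ℝ) < 1 / 2) (by norm_num : (0 : ℝ) < 1 / 2)
    (by norm_num)
  set m := (1 / 2 : ℝ) • x + (1 / 2 : ℝ) • y with hmdef
  have hmt : inner ℝ (u t) m = supportFn K t := by
    rw [hmdef, inner_add_right, inner_smul_right, inner_smul_right, hxt, hyt]; ring
  obtain ⟨ε, hε, hball⟩ := Metric.isOpen_iff.1 isOpen_interior m hm
  have hmem : m + (ε / 2) • u t ∈ K := by
    refine interior_subset (hball ?_)
    simp [norm_smul, norm_u, abs_of_pos hε, hε]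
  have := inner_le_supportFn hK t hmem
  rw [inner_add_right, inner_smul_right, real_inner_self_eq_norm_sq, norm_u, hmt] at this
  linarith

/-- The support point of a strictly convex body depends continuously on the direction. -/
lemma tendsto_supportPoint (hK : IsCompact K) (hs : StrictConvex ℝ K) {X : ℝ → Plane}
    (hX : ∀ s, X s ∈ K) (hXp : ∀ s, inner ℝ (u s) (X s) = supportFn K s) (t : ℝ) :
    Tendsto X (𝓝 t) (𝓝 (X t)) := by
  refine hK.tendsto_nhds_of_unique_mapClusterPt (Eventually.of_forall hX) fun y hy hcl => ?_
  obtain ⟨U, hU, hUy⟩ := mapClusterPt_iff_ultrafilter.1 hcl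
  have hu : Tendsto u U (𝓝 (u t)) := (hasDerivAt_u t).continuousAt.tendsto.mono_left hU
  refine eq_of_inner_eq_supportFn hK hs hy (hX t) ?_ (hXp t)
  refine le_antisymm (inner_le_supportFn hK t hy) ?_
  rw [← hXp t]
  refine le_of_tendsto_of_tendsto (hu.inner tendsto_const_nhds) (hu.inner hUy)
    (Eventually.of_forall fun s => ?_)
  show inner ℝ (u s) (X t) ≤ inner ℝ (u s) (X s)
  rw [hXp s]
  exact inner_le_supportFn hK s (hX t)

/-- The envelope argument: `p s` differs from `⟪u s, X t⟫` by at most `⟪u s - u t, X s - X t⟫`,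
where `X` denotes the support point, and this is `o(s - t)`. -/
lemma differentiable_supportFn (hK : IsCompact K) (hne : K.Nonempty) (hs : StrictConvex ℝ K) :
    Differentiable ℝ (supportFn K) := by
  intro t
  choose X hX hXp using exists_inner_eq_supportFn hK hne
  have hlin : HasDerivAt (fun s => inner ℝ (u s) (X t)) (inner ℝ (u' t) (X t)) t := by
    simpa using (hasDerivAt_u t).inner ℝ (hasDerivAt_const t (X t))
  have hrem : HasDerivAt (fun s => supportFn K s - inner ℝ (u s) (X t)) 0 t := by
    rw [hasDerivAt_iff_isLittleO]
    have h1 : (fun s => u s - u t) =O[𝓝 t] fun s => s - t := (hasDerivAt_u t).isBigO_sub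
    have h2 : (fun s => X s - X t) =o[𝓝 t] fun _ => (1 : ℝ) := by
      rw [isLittleO_one_iff]
      simpa using (tendsto_supportPoint hK hs hX hXp t).sub_const (X t)
    have h3 := h1.norm_left.mul_isLittleO h2.norm_left
    simp only [mul_one] at h3
    refine IsBigO.trans_isLittleO (IsBigO.of_bound 1 (Eventually.of_forall fun s => ?_)) h3
    have e1 := inner_le_supportFn hK s (hX t)
    have e2 := inner_le_supportFn hK t (hX s)
    have e3 := real_inner_le_norm (u s - u t) (X s - X t)
    simp only [inner_sub_left, inner_sub_right, hXp] at e3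
    simp only [hXp, sub_self, smul_zero, sub_zero, one_mul, Real.norm_eq_abs, abs_mul, abs_norm]
    rw [abs_of_nonneg (by linarith)]
    linarith
  have hsum := (hrem.add hlin).differentiableAt
  rwa [show (fun s => supportFn K s - inner ℝ (u s) (X t)) + (fun s => inner ℝ (u s) (X t)) =
    supportFn K from funext fun s => sub_add_cancel _ _] at hsum

/-- A convex body is determined by its support function; here in the case of a disc. -/
lemma eq_closedBall_of_supportFn_eq (hK : IsCompact K) (hne : K.Nonempty) (hconv : Convex ℝ K)
    {z : Plane} {r : ℝ} (hp : ∀ t, supportFn K t = r + inner ℝ (u t) z) :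
    K = Metric.closedBall z r := by
  apply Set.Subset.antisymm
  · intro x hx
    obtain ⟨t, ht⟩ := exists_eq_norm_smul_u (x - z)
    have h1 := inner_le_supportFn hK t hx
    have h2 : inner ℝ (u t) (x - z) = ‖x - z‖ := by
      conv_lhs => rw [ht]
      rw [inner_smul_right, real_inner_self_eq_norm_sq, norm_u]; ring
    rw [inner_sub_right] at h2
    rw [mem_closedBall_iff_norm]
    linarith [hp t]
  · intro x hx
    by_contra hxK
    obtain ⟨φ, d, hφ, hφx⟩ := geometric_hahn_banach_closed_point hconv hK.isClosed hxK
    obtain ⟨w, rfl⟩ := (InnerProductSpace.toDual ℝ Plane).surjective φ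
    simp only [InnerProductSpace.toDual_apply_apply] at hφ hφx
    obtain ⟨t, ht⟩ := exists_eq_norm_smul_u w
    obtain ⟨y, hy, hyt⟩ := exists_inner_eq_supportFn hK hne t
    have h1 := (hφ y hy).trans hφx
    rw [ht, real_inner_smul_left, real_inner_smul_left, hyt, hp t] at h1
    have h2 : r + inner ℝ (u t) z < inner ℝ (u t) x := lt_of_mul_lt_mul_left h1 (norm_nonneg w)
    have h3 := real_inner_le_norm (u t) (x - z)
    rw [inner_sub_right, norm_u, one_mul] at h3
    rw [mem_closedBall_iff_norm] at hx
    linarith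

/-- A body with interior points has positive width in every direction. -/
lemma supportFn_add_supportFn_add_pi_pos (hK : IsCompact K) (hint : (interior K).Nonempty)
    (t : ℝ) : 0 < supportFn K t + supportFn K (t + π) := by
  obtain ⟨m, hm⟩ := hint
  obtain ⟨ε, hε, hball⟩ := Metric.isOpen_iff.1 isOpen_interior m hm
  have hmem : m + (ε / 2) • u t ∈ K := by
    refine interior_subset (hball ?_)
    simp [norm_smul, norm_u, abs_of_pos hε, hε]
  have h1 := inner_le_supportFn hK t hmem
  have h2 := inner_le_supportFn hK (t + π) (interior_subset hm)
  rw [inner_add_right, inner_smul_right, real_inner_self_eq_norm_sq, norm_u] at h1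
  rw [inner_u] at h1 h2
  rw [cos_add_pi, sin_add_pi] at h2
  linarith

end Support

/-! ### The two chords in terms of the support function -/

/-- The signed length of the isoptic chord on `ℓ(t + b)`, where `b = π - α`. -/
lemma isopticPt_sub_isopticPt (K : Set Plane) {b : ℝ} (hb : sin b ≠ 0) (t : ℝ) :
    isopticPt K (π - b) t - isopticPt K (π - b) (t + b) =
      (-(supportFn K (t + b + b) - 2 * cos b * supportFn K (t + b) + supportFn K t) / sin b) •
        u' (t + b) := by
  have e : ∀ s, s + π - (π - b) = s + b := fun s => by ring
  have hc : sin b ^ 2 + cos b ^ 2 = 1 := sin_sq_add_cos_sq b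
  -- The frame at `t` is written in terms of the frame at `t + b`.
  have ht : cos t = cos (t + b) * cos b + sin (t + b) * sin b := by
    rw [← cos_sub]; congr 1; ring
  have ht' : sin t = sin (t + b) * cos b - cos (t + b) * sin b := by
    rw [← sin_sub]; congr 1; ring
  simp only [isopticPt, e, Real.cot_eq_cos_div_sin, cos_pi_sub, sin_pi_sub]
  ext i
  fin_cases i
  · simp only [u, u', ht, ht']
    simp
    field_simp
    linear_combination sin (t + b) * supportFn K t * hc
  · simp only [u, u', ht, ht']
    simp
    field_simp
    linear_combination (-(cos (t + b) * supportFn K t)) * hc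

lemma isopticChord_eq (K : Set Plane) {b : ℝ} (hb : 0 < sin b) (t : ℝ) :
    isopticChord K (π - b) t =
      |supportFn K (t + b + b) - 2 * cos b * supportFn K (t + b) + supportFn K t| / sin b := by
  have e : t + π - (π - b) = t + b := by ring
  rw [isopticChord, e, dist_eq_norm, isopticPt_sub_isopticPt K hb.ne', norm_smul, norm_u', mul_one,
    Real.norm_eq_abs, abs_div, abs_neg, abs_of_pos hb]

/-- The squared contact chord as a quadratic form in the coordinates of the two contact points in
their respective frames (law of cosines). -/
lemma contactChord_sq_eq (K : Set Plane) (b t : ℝ) :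
    contactChord K (π - b) t ^ 2 =
      supportFn K t ^ 2 + deriv (supportFn K) t ^ 2 +
        supportFn K (t + b) ^ 2 + deriv (supportFn K) (t + b) ^ 2 -
        2 * cos b * (supportFn K t * supportFn K (t + b) +
          deriv (supportFn K) t * deriv (supportFn K) (t + b)) +
        2 * sin b * (supportFn K t * deriv (supportFn K) (t + b) -
          deriv (supportFn K) t * supportFn K (t + b)) := by
  have e : t + π - (π - b) = t + b := by ring
  have h₀ : sin t ^ 2 + cos t ^ 2 = 1 := sin_sq_add_cos_sq t
  have h₁ : sin (t + b) ^ 2 + cos (t + b) ^ 2 = 1 := sin_sq_add_cos_sq (t + b)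
  have hc : cos b = cos (t + b) * cos t + sin (t + b) * sin t := by
    rw [← cos_sub]; congr 1; ring
  have hs : sin b = sin (t + b) * cos t - cos (t + b) * sin t := by
    rw [← sin_sub]; congr 1; ring
  rw [contactChord, e, dist_eq_norm, ← real_inner_self_eq_norm_sq, inner_plane]
  simp [contactPt, u, u']
  rw [hc, hs]
  linear_combination (supportFn K t ^ 2 + deriv (supportFn K) t ^ 2) * h₀ +
    (supportFn K (t + b) ^ 2 + deriv (supportFn K) (t + b) ^ 2) * h₁

/-- The squared contact chord, where `a₀` and `a₁` are the displacements of the two contact points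
along their support lines, relative to the position prescribed by the values of `p - r` at `t` and
`t + b`. -/
lemma contactChord_sq (K : Set Plane) {b r a₀ a₁ : ℝ} (hb : sin b ≠ 0) (t : ℝ)
    (h₀ : sin b * a₀ = sin b * deriv (supportFn K) t -
      ((supportFn K (t + b) - r) - cos b * (supportFn K t - r)))
    (h₁ : sin b * a₁ = sin b * deriv (supportFn K) (t + b) -
      (cos b * (supportFn K (t + b) - r) - (supportFn K t - r))) :
    contactChord K (π - b) t ^ 2 = 2 * r ^ 2 * (1 - cos b) +
      (a₁ ^ 2 + a₀ ^ 2 - 2 * cos b * a₀ * a₁) + 2 * r * sin b * (a₁ - a₀) := by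
  have hc : sin b ^ 2 + cos b ^ 2 = 1 := sin_sq_add_cos_sq b
  -- In the frame at `t` the common point of the two support lines, shifted inwards by `r`,
  -- has coordinates `(f, h)`; those in the frame at `t + b` are obtained by a rotation.
  obtain ⟨f, hf⟩ : ∃ f, f = supportFn K t - r := ⟨_, rfl⟩
  obtain ⟨h, hh⟩ : ∃ h, h = deriv (supportFn K) t - a₀ := ⟨_, rfl⟩
  have e₀ : supportFn K t = f + r := by rw [hf]; ring
  have e₁ : deriv (supportFn K) t = a₀ + h := by rw [hh]; ring
  rw [e₀, e₁] at h₀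
  rw [e₀] at h₁
  have e₂ : supportFn K (t + b) = r + cos b * f + sin b * h := by linear_combination h₀
  rw [e₂] at h₁
  have e₃ : deriv (supportFn K) (t + b) = a₁ - sin b * f + cos b * h := by
    apply mul_left_cancel₀ hb
    linear_combination -h₁ + f * hc
  rw [contactChord_sq_eq, e₀, e₁, e₂, e₃]
  linear_combination (-(f ^ 2 + h ^ 2 + 2 * r * f + 2 * a₀ * h)) * hc

/-! ### The rotation recurrence -/

/-- Constancy of the isoptic chord makes `p - r` satisfy the rotation recurrence. -/
lemma exists_const_rotationRecurrence {p : ℝ → ℝ} (hp : Continuous p) {b c : ℝ} (hc : 0 < c)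
    (hb : cos b ≠ 1)
    (h : ∀ t, |p (t + b + b) - 2 * cos b * p (t + b) + p t| = c) :
    ∃ r : ℝ, r ≠ 0 ∧ ∀ t, (p (t + b + b) - r) = 2 * cos b * (p (t + b) - r) - (p t - r) := by
  have hb' : 1 - cos b ≠ 0 := sub_ne_zero.2 hb.symm
  have key := isPreconnected_univ.eq_or_eq_neg_of_sq_eq
    (f := fun t => p (t + b + b) - 2 * cos b * p (t + b) + p t) (g := fun _ : ℝ => c)
    (by fun_prop) (by fun_prop) (fun t _ => by simp [← h t]) (fun _ => hc.ne')
  rcases key with key | key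
  · refine ⟨c / (2 * (1 - cos b)), by positivity, fun t => ?_⟩
    have := key (Set.mem_univ t)
    simp only at this
    field_simp
    linear_combination 2 * (1 - cos b) * this
  · refine ⟨-c / (2 * (1 - cos b)), div_ne_zero (neg_ne_zero.2 hc.ne') (by positivity), fun t => ?_⟩
    have := key (Set.mem_univ t)
    simp only [Pi.neg_apply] at this
    field_simp
    linear_combination 2 * (1 - cos b) * this

/-- A solution of the rotation recurrence vanishes if the inhomogeneous quadratic expression coming
from the contact chord is invariant under `t ↦ t + b`. -/
lemma eq_zero_of_rotationRecurrence {a : ℝ → ℝ} {b k d : ℝ} (hk : k ≠ 0) (hb : cos b ≠ 1)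
    (hrec : ∀ t, a (t + b + b) = 2 * cos b * a (t + b) - a t)
    (hconst : ∀ t, a (t + b) ^ 2 + a t ^ 2 - 2 * cos b * a t * a (t + b) +
      k * (a (t + b) - a t) = d) (t : ℝ) : a t = 0 := by
  have hb' : 1 - cos b ≠ 0 := sub_ne_zero.2 hb.symm
  have h (s : ℝ) : a (s + b) = 0 := by
    have h0 := hconst s
    have h1 := hconst (s + b)
    rw [hrec s] at h1
    have : k * (1 - cos b) * a (s + b) = 0 := by linear_combination (h0 - h1) / 2
    simpa [hk, hb'] using this
  simpa using h (t - b)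

/-- If `f' = h` for the function `h t = (f (t + b) - cos b * f t) / sin b` attached to a solution
`f` of the rotation recurrence, then `h' = -f`, so `f` is a combination of `cos` and `sin`. -/
lemma eq_cos_sin_of_deriv_eq {f : ℝ → ℝ} {b : ℝ} (hb : sin b ≠ 0)
    (hrec : ∀ t, f (t + b + b) = 2 * cos b * f (t + b) - f t)
    (hf : ∀ t, HasDerivAt f ((f (t + b) - cos b * f t) / sin b) t) :
    ∃ A B : ℝ, ∀ t, f t = A * cos t + B * sin t := by
  set h : ℝ → ℝ := fun t => (f (t + b) - cos b * f t) / sin b with hh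
  have hh' (t : ℝ) : HasDerivAt h (-f t) t := by
    have h1 := (((hf (t + b)).comp_add_const t b).sub ((hf t).const_mul (cos b))).div_const (sin b)
    refine h1.congr_deriv ?_
    rw [hrec]
    field_simp
    linear_combination f t * sin_sq_add_cos_sq b
  have hA (t : ℝ) : HasDerivAt (fun t => f t * cos t - h t * sin t) 0 t := by
    refine (((hf t).mul (hasDerivAt_cos t)).sub ((hh' t).mul (hasDerivAt_sin t))).congr_deriv ?_
    simp only [hh]; ring
  have hB (t : ℝ) : HasDerivAt (fun t => f t * sin t + h t * cos t) 0 t := by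
    refine (((hf t).mul (hasDerivAt_sin t)).add ((hh' t).mul (hasDerivAt_cos t))).congr_deriv ?_
    simp only [hh]; ring
  refine ⟨f 0 * cos 0 - h 0 * sin 0, f 0 * sin 0 + h 0 * cos 0, fun t => ?_⟩
  have eA := is_const_of_deriv_eq_zero (fun t => (hA t).differentiableAt) (fun t => (hA t).deriv) t 0
  have eB := is_const_of_deriv_eq_zero (fun t => (hB t).differentiableAt) (fun t => (hB t).deriv) t 0
  rw [← eA, ← eB]
  linear_combination (-f t) * sin_sq_add_cos_sq t

/-- Both chord conditions, imposed for every `t`, force the support function of a disc. -/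
lemma exists_supportFn_eq {K : Set Plane} (hp : Differentiable ℝ (supportFn K)) {b c q : ℝ}
    (hb : b ∈ Set.Ioo 0 π) (hc : 0 < c) (hic : ∀ t, isopticChord K (π - b) t = c)
    (hcc : ∀ t, contactChord K (π - b) t = q) :
    ∃ (r : ℝ) (z : Plane), ∀ t, supportFn K t = r + inner ℝ (u t) z := by
  have hsin : 0 < sin b := sin_pos_of_mem_Ioo hb
  have hcos : cos b ≠ 1 := fun h => by
    have := sin_sq_add_cos_sq b
    rw [h] at this
    nlinarith
  obtain ⟨r, hr, hrec⟩ := exists_const_rotationRecurrence hp.continuous (mul_pos hc hsin) hcos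
    fun t => by rw [← hic t, isopticChord_eq K hsin, div_mul_cancel₀ _ hsin.ne']
  have hdrec (t : ℝ) : deriv (supportFn K) (t + b + b) =
      2 * cos b * deriv (supportFn K) (t + b) - deriv (supportFn K) t := by
    have h1 (s : ℝ) := (hp s).hasDerivAt
    have h2 := ((h1 (t + b + b)).comp_add_const (t + b) b).comp_add_const t b
    have h3 := ((((h1 (t + b)).comp_add_const t b).sub_const r).const_mul (2 * cos b)).sub
      ((h1 t).sub_const r)
    refine (h2.sub_const r).unique (h3.congr_of_eventuallyEq (Eventually.of_forall fun s => ?_))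
    exact hrec s
  set a : ℝ → ℝ := fun t => deriv (supportFn K) t -
    ((supportFn K (t + b) - r) - cos b * (supportFn K t - r)) / sin b with ha
  have harec (t : ℝ) : a (t + b + b) = 2 * cos b * a (t + b) - a t := by
    simp only [ha]
    rw [hdrec, hrec (t + b), hrec t]
    field_simp
    ring
  have hzero := eq_zero_of_rotationRecurrence (a := a) (k := 2 * r * sin b)
    (d := q ^ 2 - 2 * r ^ 2 * (1 - cos b))
    (by positivity) hcos harec fun t => by
      rw [← hcc t, contactChord_sq K (r := r) (a₀ := a t) (a₁ := a (t + b)) hsin.ne' t ?_ ?_]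
      · ring
      · simp only [ha]; field_simp
      · simp only [ha]; rw [hrec t]; field_simp; ring
  obtain ⟨A, B, hAB⟩ := eq_cos_sin_of_deriv_eq (f := fun t => supportFn K t - r) hsin.ne' hrec
    fun t => ((hp t).hasDerivAt.sub_const r).congr_deriv (sub_eq_zero.1 (hzero t))
  refine ⟨r, !₂[A, B], fun t => ?_⟩
  rw [inner_u]
  simp only [Matrix.cons_val_zero, Matrix.cons_val_one]
  linear_combination hAB t

/-! ### The characterisation of the disc -/

lemma periodic_isopticChord (K : Set Plane) (α : ℝ) :
    Function.Periodic (isopticChord K α) (2 * π) := by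
  have hpt (t : ℝ) : isopticPt K α (t + 2 * π) = isopticPt K α t := by
    have e : t + 2 * π + π - α = t + π - α + 2 * π := by ring
    simp [isopticPt, e, supportFn_add_two_pi, u, u']
  intro t
  have e : t + 2 * π + π - α = t + π - α + 2 * π := by ring
  simp only [isopticChord, e, hpt]

lemma periodic_contactChord (K : Set Plane) (α : ℝ) :
    Function.Periodic (contactChord K α) (2 * π) := by
  have hd (t : ℝ) : deriv (supportFn K) (t + 2 * π) = deriv (supportFn K) t := by
    rw [← deriv_comp_add_const]
    simp only [supportFn_add_two_pi]
  have hpt (t : ℝ) : contactPt K (t + 2 * π) = contactPt K t := by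
    simp [contactPt, hd, supportFn_add_two_pi, u, u']
  intro t
  have e : t + 2 * π + π - α = t + π - α + 2 * π := by ring
  simp only [contactChord, e, hpt]

lemma eq_of_periodic_of_eq_on_Icc {g : ℝ → ℝ} {T c : ℝ} (hT : 0 < T) (hg : Function.Periodic g T)
    (h : ∀ t ∈ Set.Icc 0 T, g t = c) (t : ℝ) : g t = c := by
  obtain ⟨s, hs, hst⟩ := hg.exists_mem_Ico₀ hT t
  rw [hst, h s ⟨hs.1, hs.2.le⟩]

end PlanarIsoptic

theorem mainTheorem4
    (K : ConvexBody PlanarIsoptic.Plane)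
    (hint : (interior (K : Set PlanarIsoptic.Plane)).Nonempty)
    (hstrict : StrictConvex ℝ (K : Set PlanarIsoptic.Plane))
    (hdiff : PlanarIsoptic.HasDifferentiableBoundary (K : Set PlanarIsoptic.Plane))
    (α : ℝ) (hα : α ∈ Set.Ioo 0 Real.pi)
    (c₀ q₀ : ℝ) (hc₀ : 0 < c₀) (hq₀ : 0 < q₀)
    (hc : ∀ t ∈ Set.Icc 0 (2 * Real.pi),
      PlanarIsoptic.isopticChord (K : Set PlanarIsoptic.Plane) α t = c₀)
    (hq : ∀ t ∈ Set.Icc 0 (2 * Real.pi),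
      PlanarIsoptic.contactChord (K : Set PlanarIsoptic.Plane) α t = q₀) :
    PlanarIsoptic.IsDisc (K : Set PlanarIsoptic.Plane) := by
  open PlanarIsoptic in
  have hα' : Real.pi - (Real.pi - α) = α := sub_sub_cancel _ _
  obtain ⟨r, z, hp⟩ := exists_supportFn_eq (b := Real.pi - α) (c := c₀) (q := q₀)
    (differentiable_supportFn K.isCompact K.nonempty hstrict)
    ⟨by linarith [hα.2], by linarith [hα.1]⟩ hc₀
    (by
      rw [hα']
      exact eq_of_periodic_of_eq_on_Icc Real.two_pi_pos (periodic_isopticChord _ _) hc)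
    (by
      rw [hα']
      exact eq_of_periodic_of_eq_on_Icc Real.two_pi_pos (periodic_contactChord _ _) hq)
  refine ⟨z, r, ?_, eq_closedBall_of_supportFn_eq K.isCompact K.nonempty K.convex hp⟩
  -- The width of `K` is the constant `2 r`.
  have hw := supportFn_add_supportFn_add_pi_pos K.isCompact hint 0
  rw [hp, hp, inner_u, inner_u, Real.cos_add_pi, Real.sin_add_pi] at hw
  linarith
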